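/- Let $\Gamma$ be a connected graph, regarded as a geodesic metric space with all edges of length one, which is $\delta$-hyperbolic for some $\delta \ge 0$: for every geodesic triangle, each side is contained in the $\delta$-neighborhood of the union of the other two. Let a group $G$ act on $\Gamma$ by isometries, and suppose that the action is acylindrical: for every $R>0$ there are constants $K(R), L(R) \ge 1$ such that for all vertices $x,y$ of $\Gamma$ with $d(x,y) \ge L(R)$, at most $K(R)$ elements $h \in G$ satisfy both $d(x,hx) \le R$ and $d(y,hy)\le R$. An element $a \in G$ acts hyperbolically if there are a point $x \in \Gamma$ and a constant $C>0$ with $d(x,a^n x) \ge Cn$ for all integers $n>0$; a quasi-axis of $a$ is a bi-infinite geodesic $\alpha$ in $\Gamma$ such that $a(\alpha)$ is contained in the $C$-neighborhood of $\alpha$ for some $C \ge 0$. Let $f,g \in G$ act hyperbolically, with quasi-axes $\alpha$ and $\beta$ respectively, and assume that the commutator $[f^s,g^t]$ is non-trivial for all non-zero integers $s,t$. Then there is an integer $N>0$, depending on $f$ and $g$, such that for every integer $n \ge N$ the subgroup $\langle g, f^n\rangle$ of $G$ is free of rank two, and its embedding in $\Gamma$ by an orbit is quasi-isometric: for every point $x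 \in \Gamma$ and every finite generating set of $\langle g, f^n\rangle$, with word length $|\cdot|$, there are constants $L, C>0$ such that $$\frac{|w|}{L} - C \le d(x, w x) \le L|w| + C \qquad \text{for all } w \in \langle g, f^n \rangle.$$ -/

import Mathlib

open scoped unitInterval

/-- `EdgePathLength E x y l`: there is a piecewise linear path from `x` to `y` of length `l`, i.e. a
finite concatenation of pieces, each running inside one edge of `E` from parameter `s` to
parameter `t` and contributing length `|s - t|`. -/
inductive EdgePathLength {X : Type*} (E : Set (I → X)) : X → X → ℝ → Prop
  | nil (x : X) : EdgePathLength E x x 0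
  | cons (e : I → X) (he : e ∈ E) (s t : I) (y : X) (l : ℝ) (h : EdgePathLength E (e t) y l) :
      EdgePathLength E (e s) y (|(s : ℝ) - (t : ℝ)| + l)

/-- The structure of a connected graph (loops and multiple edges are allowed, no finiteness is
assumed) on a metric space `X`: `X` is the geometric realization of the graph, every edge has
length one, and the distance is the path metric. Each edge is given by its characteristic map
from the unit interval. Connectedness is implied by `dist_isGLB`, as the empty set of reals has
no greatest lower bound. -/
structure MetricGraph (X : Type*) [MetricSpace X] where
  /-- the vertices -/
  vertices : Set X
  /-- the characteristic maps of the edges, one for each edge -/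
  edges : Set (I → X)
  /-- the end points of an edge are vertices -/
  zero_mem : ∀ e ∈ edges, e 0 ∈ vertices
  /-- the end points of an edge are vertices -/
  one_mem : ∀ e ∈ edges, e 1 ∈ vertices
  /-- an open edge contains no vertex -/
  interior_notMem : ∀ e ∈ edges, ∀ s : I, s ≠ 0 → s ≠ 1 → e s ∉ vertices
  /-- open edges are embedded and pairwise disjoint -/
  interior_inj : ∀ e ∈ edges, ∀ e' ∈ edges, ∀ s s' : I, s ≠ 0 → s ≠ 1 → s' ≠ 0 → s' ≠ 1 →
    e s = e' s' → e = e' ∧ s = s'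
  /-- the vertices and the edges cover the space -/
  cover : ∀ x : X, x ∈ vertices ∨ ∃ e ∈ edges, ∃ s : I, e s = x
  /-- the distance is the infimum of the lengths of the piecewise linear paths -/
  dist_isGLB : ∀ x y : X, IsGLB {l : ℝ | EdgePathLength edges x y l} (dist x y)

/-- `α` is (the image of) a geodesic segment joining `x` to `y`. -/
def IsGeodesicSegment {X : Type*} [MetricSpace X] (α : Set X) (x y : X) : Prop :=
  ∃ γ : ℝ → X, γ 0 = x ∧ γ (dist x y) = y ∧
    (∀ s ∈ Set.Icc 0 (dist x y), ∀ t ∈ Set.Icc 0 (dist x y), dist (γ s) (γ t) = |s - t|) ∧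
    α = γ '' Set.Icc 0 (dist x y)

/-- `α` is (the image of) a bi-infinite geodesic. -/
def IsGeodesicLine {X : Type*} [MetricSpace X] (α : Set X) : Prop :=
  ∃ γ : ℝ → X, Isometry γ ∧ α = Set.range γ

/-- `A` is contained in the (closed) `r`-neighborhood of `B`. -/
def InNeighborhood {X : Type*} [MetricSpace X] (A : Set X) (r : ℝ) (B : Set X) : Prop :=
  ∀ p ∈ A, ∃ q ∈ B, dist p q ≤ r

/-- Any two points are joined by a geodesic segment. -/
def IsGeodesicSpace (X : Type*) [MetricSpace X] : Prop :=
  ∀ x y : X, ∃ α : Set X, IsGeodesicSegment α x y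

/-- `X` is a `δ`-hyperbolic geodesic space: geodesic triangles are `δ`-slim. -/
def IsHyperbolicSpace (X : Type*) [MetricSpace X] (δ : ℝ) : Prop :=
  IsGeodesicSpace X ∧
    ∀ (x y z : X) (α β γ : Set X), IsGeodesicSegment α x y → IsGeodesicSegment β y z →
      IsGeodesicSegment γ z x → InNeighborhood α δ (β ∪ γ)

/-- `a` acts on `X` as a hyperbolic isometry. -/
def ActsHyperbolically {G : Type*} [Group G] (X : Type*) [MetricSpace X] [MulAction G X]
    (a : G) : Prop :=
  ∃ x : X, ∃ C : ℝ, 0 < C ∧ ∀ n : ℕ, 0 < n → C * n ≤ dist x (a ^ n • x)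

/-- The set `α` is a quasi-axis of `a`: a bi-infinite geodesic that `a` maps into its own
`C`-neighborhood for some `C ≥ 0`. -/
def IsQuasiAxis {G : Type*} [Group G] {X : Type*} [MetricSpace X] [MulAction G X]
    (a : G) (α : Set X) : Prop :=
  IsGeodesicLine α ∧ ∃ C : ℝ, 0 ≤ C ∧ InNeighborhood ((fun p => a • p) '' α) C α

/-- The action of `G` on the graph `Γ` is acylindrical. -/
def MetricGraph.IsAcylindrical {X : Type*} [MetricSpace X] (Γ : MetricGraph X)
    (G : Type*) [Group G] [MulAction G X] : Prop :=
  ∀ R : ℝ, 0 < R → ∃ K : ℕ, ∃ L : ℝ, 1 ≤ K ∧ 1 ≤ L ∧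
    ∀ x ∈ Γ.vertices, ∀ y ∈ Γ.vertices, L ≤ dist x y →
      {g : G | dist x (g • x) ≤ R ∧ dist y (g • y) ≤ R}.encard ≤ K

/-- The word length of `a` with respect to a generating set `S`: the least length of a word in
the letters `S ∪ S⁻¹` that represents `a`. -/
noncomputable def wordLength {H : Type*} [Group H] (S : Set H) (a : H) : ℕ :=
  sInf {k : ℕ | ∃ w : List H, (∀ u ∈ w, u ∈ S ∨ u⁻¹ ∈ S) ∧ w.prod = a ∧ w.length = k}

/-- The orbit map `a ↦ a • x` of a group `H` with finite generating set `S` is quasi-isometric. -/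
def IsQuasiIsometricOrbit {H : Type*} [Group H] {X : Type*} [MetricSpace X] [MulAction H X]
    (S : Set H) (x : X) : Prop :=
  ∃ L C : ℝ, 0 < L ∧ 0 < C ∧ ∀ a : H,
    (wordLength S a : ℝ) / L - C ≤ dist x (a • x) ∧ dist x (a • x) ≤ L * wordLength S a + C

/-! Write |a| for d(o, a o) and (x|y) for Gromov products at o. Since |uv| = |u| + |v| - 2(u⁻¹o |
vo), the displacement of a word in g and F = f^n grows linearly once the products at its junctions
are bounded and every |F^b| with b ≠ 0 outweighs these bounds (`FourPoint.le_dist_alternatingProd`).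
This one lower bound gives both freeness and the quasi-isometric orbit. What is needed is a constant
D with (f^r o | g^a f^l o) ≤ D for all r, l and all a ≠ 0 (`exists_gromovProduct_zpow_mul_zpow_le`).
The same D serves every power of f, while |f^n| tends to infinity, so every large n works.

The constant D comes from acylindricity. The quasi-axis makes n ↦ |f^n| additive up to a bounded
error (`FourPoint.exists_superadditive`). Hence, for bounded |h|, a large product (f^r o | h f^l o)
forces the two orbits to fellow travel. The elements h f^s h⁻¹ f^(-s) then move two distant points
by a bounded amount, and by pigeonhole h conjugates some f^j to itself, or to its inverse when the
two orbits run in opposite directions (`MetricGraph.IsAcylindrical.exists_gromovProduct_le`). For h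
a nontrivial power of g this contradicts the commutator hypothesis. The case h = g separates the
orbits of ⟨f⟩ and ⟨g⟩, which settles the g^a of large displacement; the others have bounded |g^a|
and are covered by h = g^a. -/

/-- The Gromov product of `x` and `y` based at `o`. -/
noncomputable def gromovProduct {X : Type*} [MetricSpace X] (o x y : X) : ℝ :=
  (dist o x + dist o y - dist x y) / 2

/-- Gromov's four-point condition. -/
def FourPoint (X : Type*) [MetricSpace X] (d : ℝ) : Prop :=
  ∀ o x y z : X, min (gromovProduct o x y) (gromovProduct o y z) ≤ gromovProduct o x z + d

/-! ### From slim triangles to the four-point condition -/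

section Slim

variable {X : Type*} [MetricSpace X]

theorem IsGeodesicSegment.left_mem {α : Set X} {x y : X} (h : IsGeodesicSegment α x y) :
    x ∈ α := by
  obtain ⟨γ, h0, -, -, rfl⟩ := h
  exact ⟨0, ⟨le_rfl, dist_nonneg⟩, h0⟩

theorem IsGeodesicSegment.right_mem {α : Set X} {x y : X} (h : IsGeodesicSegment α x y) :
    y ∈ α := by
  obtain ⟨γ, -, h1, -, rfl⟩ := h
  exact ⟨dist x y, ⟨dist_nonneg, le_rfl⟩, h1⟩

theorem IsGeodesicSegment.dist_add_dist {α : Set X} {x y p : X} (h : IsGeodesicSegment α x y)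
    (hp : p ∈ α) : dist x p + dist p y = dist x y := by
  obtain ⟨γ, h0, h1, h2, rfl⟩ := h
  obtain ⟨t, ht, rfl⟩ := hp
  have e0 := h2 0 ⟨le_rfl, dist_nonneg⟩ t ht
  have e1 := h2 t ht (dist x y) ⟨dist_nonneg, le_rfl⟩
  rw [h0, zero_sub, abs_neg, abs_of_nonneg ht.1] at e0
  rw [h1, abs_of_nonpos (by linarith [ht.2])] at e1
  linarith

theorem gromovProduct_le_dist_of_mem {α : Set X} {x y p : X} (h : IsGeodesicSegment α x y)
    (hp : p ∈ α) (o : X) : gromovProduct o x y ≤ dist o p := by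
  have := h.dist_add_dist hp
  have h1 := dist_triangle o p x
  have h2 := dist_triangle o p y
  rw [dist_comm p x] at h1
  unfold gromovProduct
  linarith

/-- A closed cover of a geodesic segment by two sets that contain one end point each has a
common point. -/
theorem IsGeodesicSegment.exists_infDist_le {α A B : Set X} {x y : X} {r : ℝ}
    (h : IsGeodesicSegment α x y) (hx : x ∈ A) (hy : y ∈ B) (hr : 0 ≤ r)
    (hAB : InNeighborhood α r (B ∪ A)) :
    ∃ p ∈ α, Metric.infDist p A ≤ r ∧ Metric.infDist p B ≤ r := by
  obtain ⟨γ, h0, h1, h2, rfl⟩ := h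
  have hc : ContinuousOn γ (Set.Icc 0 (dist x y)) := by
    have : LipschitzOnWith 1 γ (Set.Icc 0 (dist x y)) := by
      refine LipschitzOnWith.of_dist_le_mul fun s hs t ht => ?_
      rw [h2 s hs t ht, Real.dist_eq]
      simp
    exact this.continuousOn
  have hcl : ∀ S : Set X, IsClosed (Set.Icc 0 (dist x y) ∩ γ ⁻¹' {p | Metric.infDist p S ≤ r}) :=
    fun S => hc.preimage_isClosed_of_isClosed isClosed_Icc
      (isClosed_le (Metric.continuous_infDist_pt S) continuous_const)
  have key := isPreconnected_closed_iff.1 (isPreconnected_Icc (a := 0) (b := dist x y)) _ _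
    (hcl A) (hcl B) ?_ ?_ ?_
  · obtain ⟨t, ht, hA, hB⟩ := key
    exact ⟨γ t, ⟨t, ht, rfl⟩, hA.2, hB.2⟩
  · intro t ht
    obtain ⟨q, hq, hd⟩ := hAB (γ t) ⟨t, ht, rfl⟩
    rcases hq with hq | hq
    · exact Or.inr ⟨ht, (Metric.infDist_le_dist_of_mem hq).trans hd⟩
    · exact Or.inl ⟨ht, (Metric.infDist_le_dist_of_mem hq).trans hd⟩
  · refine ⟨0, ⟨le_rfl, dist_nonneg⟩, ⟨le_rfl, dist_nonneg⟩, ?_⟩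
    simpa [h0, Metric.infDist_zero_of_mem hx] using hr
  · refine ⟨dist x y, ⟨dist_nonneg, le_rfl⟩, ⟨dist_nonneg, le_rfl⟩, ?_⟩
    simpa [h1, Metric.infDist_zero_of_mem hy] using hr

/-- By connectedness some point of the side is close to both other sides, and it serves as the
centre of the triangle. Infima of distances need not be attained, hence δ + 1 in place of δ. -/
theorem IsHyperbolicSpace.exists_dist_le_gromovProduct {δ : ℝ} (hX : IsHyperbolicSpace X δ)
    (hδ : 0 ≤ δ) {α : Set X} {x y : X} (h : IsGeodesicSegment α x y) (o : X) :
    ∃ p ∈ α, dist o p ≤ gromovProduct o x y + 2 * (δ + 1) := by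
  obtain ⟨β, hβ⟩ := hX.1 y o
  obtain ⟨γ, hγ⟩ := hX.1 o x
  obtain ⟨p, hp, hpA, hpB⟩ := h.exists_infDist_le hγ.right_mem hβ.left_mem hδ
    (hX.2 x y o α β γ h hβ hγ)
  obtain ⟨a, ha, hpa⟩ := (Metric.infDist_lt_iff ⟨x, hγ.right_mem⟩).1
    (lt_of_le_of_lt hpA (lt_add_one δ))
  obtain ⟨b, hb, hpb⟩ := (Metric.infDist_lt_iff ⟨y, hβ.left_mem⟩).1
    (lt_of_le_of_lt hpB (lt_add_one δ))
  refine ⟨p, hp, ?_⟩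
  have e1 := h.dist_add_dist hp
  have e2 := hγ.dist_add_dist ha
  have e3 := hβ.dist_add_dist hb
  have t1 := dist_triangle x a p
  have t2 := dist_triangle p b y
  have t3 := dist_triangle o a p
  have t4 := dist_triangle o b p
  simp only [gromovProduct, dist_comm a p, dist_comm b p, dist_comm x a, dist_comm b y,
    dist_comm b o, dist_comm y o] at *
  linarith

/-- Slim triangles imply the four-point condition. -/
theorem IsHyperbolicSpace.fourPoint {δ : ℝ} (hX : IsHyperbolicSpace X δ) (hδ : 0 ≤ δ) :
    FourPoint X (3 * δ + 2) := by
  intro o x y z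
  obtain ⟨α, hα⟩ := hX.1 x z
  obtain ⟨β, hβ⟩ := hX.1 z y
  obtain ⟨γ, hγ⟩ := hX.1 y x
  -- The point p nearly realizes the product of x and z, up to 2(δ + 1). Slimness puts it within δ
  -- of another side, whose distance to o bounds the product of that side's end points; the total
  -- error is 3δ + 2.
  obtain ⟨p, hp, hop⟩ := hX.exists_dist_le_gromovProduct hδ hα o
  obtain ⟨q, hq, hpq⟩ := hX.2 x z y α β γ hα hβ hγ p hp
  have t := dist_triangle o p q
  rcases hq with hq | hq
  · refine (min_le_right _ _).trans ?_
    have := gromovProduct_le_dist_of_mem hβ hq o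
    simp only [gromovProduct, dist_comm z y] at *
    linarith
  · refine (min_le_left _ _).trans ?_
    have := gromovProduct_le_dist_of_mem hγ hq o
    simp only [gromovProduct, dist_comm y x] at *
    linarith

theorem MetricGraph.exists_vertex_dist_le (Γ : MetricGraph X) (x : X) :
    ∃ v ∈ Γ.vertices, dist v x ≤ 1 := by
  rcases Γ.cover x with hx | ⟨e, he, s, rfl⟩
  · exact ⟨x, hx, by simp⟩
  · refine ⟨e 0, Γ.zero_mem e he, ?_⟩
    refine ((Γ.dist_isGLB (e 0) (e s)).1 (.cons e he 0 s _ 0 (.nil _))).trans ?_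
    simp [abs_of_nonneg s.2.1, s.2.2]

end Slim

/-! ### Geodesic lines under the four-point condition -/

section FourPoint

variable {X : Type*} [MetricSpace X]

theorem gromovProduct_comm (o x y : X) : gromovProduct o x y = gromovProduct o y x := by
  simp only [gromovProduct, dist_comm x y]
  ring

theorem gromovProduct_smul {G : Type*} [Group G] [MulAction G X] [IsIsometricSMul G X] (a : G)
    (o x y : X) : gromovProduct (a • o) (a • x) (a • y) = gromovProduct o x y := by
  simp only [gromovProduct, dist_smul]

theorem FourPoint.exists_dist_le_of_gromovProduct_le {d : ℝ} (h4 : FourPoint X d) {γ : ℝ → X}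
    (hγ : Isometry γ) {p : X} {s t c : ℝ} (hst : s ≤ t)
    (h : gromovProduct p (γ s) (γ t) ≤ c) : ∃ u, dist p (γ u) ≤ 2 * (c + d) := by
  have e : dist (γ s) (γ t) = t - s := by
    rw [hγ.dist_eq, Real.dist_eq, abs_of_nonpos (by linarith)]
    ring
  have t1 := dist_triangle p (γ s) (γ t)
  have t2 := dist_triangle p (γ t) (γ s)
  have t3 := dist_triangle (γ s) p (γ t)
  rw [dist_comm (γ t) (γ s)] at t2
  rw [dist_comm (γ s) p] at t3
  set a := dist p (γ s)
  set b := dist p (γ t)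
  -- This is the inner point of the comparison tripod: its products with both end points, based at
  -- p, are equal.
  refine ⟨(s + t + a - b) / 2, ?_⟩
  set u := (s + t + a - b) / 2 with hu
  have e1 : dist (γ s) (γ u) = u - s := by
    rw [hγ.dist_eq, Real.dist_eq, abs_of_nonpos (by linarith)]
    ring
  have e2 : dist (γ u) (γ t) = t - u := by
    rw [hγ.dist_eq, Real.dist_eq, abs_of_nonpos (by linarith)]
    ring
  have := h4 p (γ s) (γ u) (γ t)
  simp only [gromovProduct] at this h
  rcases min_le_iff.1 this with h' | h' <;> linarith

/-- A bi-infinite geodesic in some neighborhood of another one is in a uniform neighborhood. -/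
theorem FourPoint.exists_dist_le_of_inNeighborhood {d : ℝ} (h4 : FourPoint X d)
    {γ γ' : ℝ → X} (hγ : Isometry γ) (hγ' : Isometry γ') {A : ℝ}
    (hA : ∀ t, ∃ s, dist (γ' t) (γ s) ≤ A) (t : ℝ) : ∃ s, dist (γ' t) (γ s) ≤ 6 * d := by
  have hA0 : 0 ≤ A := by
    obtain ⟨s, hs⟩ := hA 0
    exact dist_nonneg.trans hs
  have hd : 0 ≤ d := by
    have := h4 (γ 0) (γ 0) (γ 0) (γ 0)
    simpa [gromovProduct] using this
  -- Seen from γ' t, the points γ' (t ± T) are opposite, and each has product at least T - A > 2d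
  -- with its companion on γ. So the companions have product at most 2d, and A disappears from the
  -- bound.
  set T := A + 2 * d + 1 with hT
  obtain ⟨s₁, h₁⟩ := hA (t - T)
  obtain ⟨s₂, h₂⟩ := hA (t + T)
  have e1 : dist (γ' t) (γ' (t - T)) = T := by
    rw [hγ'.dist_eq, Real.dist_eq, abs_of_nonneg (by linarith)]
    ring
  have e2 : dist (γ' t) (γ' (t + T)) = T := by
    rw [hγ'.dist_eq, Real.dist_eq, abs_of_nonpos (by linarith)]
    ring
  have e3 : dist (γ' (t - T)) (γ' (t + T)) = 2 * T := by
    rw [hγ'.dist_eq, Real.dist_eq, abs_of_nonpos (by linarith)]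
    ring
  have key : gromovProduct (γ' t) (γ s₁) (γ s₂) ≤ 2 * d := by
    have i1 := h4 (γ' t) (γ' (t - T)) (γ s₁) (γ' (t + T))
    have i2 := h4 (γ' t) (γ s₁) (γ s₂) (γ' (t + T))
    have t1 := dist_triangle (γ' t) (γ s₁) (γ' (t - T))
    have t2 := dist_triangle (γ' t) (γ s₂) (γ' (t + T))
    rw [dist_comm (γ s₁) (γ' (t - T))] at t1
    rw [dist_comm (γ s₂) (γ' (t + T))] at t2
    simp only [gromovProduct, dist_comm (γ s₂) (γ' (t + T))] at *
    rcases min_le_iff.1 i1 with i1 | i1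
    · linarith
    · rcases min_le_iff.1 i2 with i2 | i2 <;> linarith
  rcases le_total s₁ s₂ with h | h
  · obtain ⟨u, hu⟩ := h4.exists_dist_le_of_gromovProduct_le hγ h key
    exact ⟨u, by linarith⟩
  · rw [gromovProduct_comm] at key
    obtain ⟨u, hu⟩ := h4.exists_dist_le_of_gromovProduct_le hγ h key
    exact ⟨u, by linarith⟩

end FourPoint

/-! ### Coarse additivity from tracking on the real line -/

section Superadditive

/-- One step of τ is at most ℓ 1 + c, while increments over at least n₀ steps exceed 2(ℓ 1 + c) in
absolute value. Shifting or lengthening such an increment by one step therefore cannot change its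
sign. All long increments are positive, and their absolute values add up. -/
theorem exists_superadditive_of_tracks_of_pos {τ ℓ : ℕ → ℝ} {c : ℝ} {n₀ : ℕ}
    (hτ : ∀ m k, |(|τ (m + k) - τ m|) - ℓ k| ≤ c)
    (hn₀ : ∀ k, n₀ ≤ k → 2 * (ℓ 1 + c) + c < ℓ k) (h0 : 0 < τ n₀ - τ 0) :
    ∀ m n, n₀ ≤ m → n₀ ≤ n → ℓ m + ℓ n ≤ ℓ (m + n) + 3 * c := by
  have hc : 0 ≤ ℓ 1 + c := by
    have h1 := (abs_le.1 (hτ 0 1)).2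
    have h2 := abs_nonneg (τ (0 + 1) - τ 0)
    linarith
  have step : ∀ m, |τ (m + 1) - τ m| ≤ ℓ 1 + c := fun m => by
    linarith [(abs_le.1 (hτ m 1)).2]
  have big : ∀ m k, n₀ ≤ k → 2 * (ℓ 1 + c) < |τ (m + k) - τ m| := fun m k hk => by
    linarith [(abs_le.1 (hτ m k)).1, hn₀ k hk]
  have pos₀ : ∀ m, 0 < τ (m + n₀) - τ m := by
    intro m
    induction m with
    | zero => simpa using h0
    | succ m ih =>
      have h1 := abs_le.1 (step m)
      have h2 := abs_le.1 (step (m + n₀))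
      have h3 := big (m + 1) n₀ le_rfl
      have h4 := big m n₀ le_rfl
      rw [abs_of_pos ih] at h4
      rw [show m + 1 + n₀ = m + n₀ + 1 by ring] at h3 ⊢
      rcases lt_abs.1 h3 with h | h <;> linarith
  have pos : ∀ m k, n₀ ≤ k → 0 < τ (m + k) - τ m := by
    intro m k hk
    induction k, hk using Nat.le_induction with
    | base => exact pos₀ m
    | succ k hk ih =>
      have h1 := abs_le.1 (step (m + k))
      have h3 := big m (k + 1) (by omega)
      have h4 := big m k hk
      rw [abs_of_pos ih] at h4
      rw [← add_assoc] at h3 ⊢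
      rcases lt_abs.1 h3 with h | h <;> linarith
  intro m n hm hn
  have a1 := pos 0 m hm
  have a2 := pos m n hn
  have b1 := abs_le.1 (hτ 0 m)
  have b2 := abs_le.1 (hτ m n)
  have b3 := abs_le.1 (hτ 0 (m + n))
  rw [abs_of_pos a1] at b1
  rw [abs_of_pos a2] at b2
  simp only [zero_add] at *
  rw [abs_of_pos (by linarith)] at b3
  linarith [b1.1, b2.1, b3.2]

/-- Reversing the line if necessary makes τ increasing on the large scale. Indices below n₀
contribute a bounded amount, which the constant absorbs. -/
theorem exists_superadditive_of_tracks {τ ℓ : ℕ → ℝ} {c C c' : ℝ} (hC : 0 < C)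
    (hτ : ∀ m k, |(|τ (m + k) - τ m|) - ℓ k| ≤ c) (hℓ : ∀ k : ℕ, C * k - c' ≤ ℓ k)
    (hsub : ∀ m n, ℓ (m + n) ≤ ℓ m + ℓ n) (hsub' : ∀ m n, ℓ n ≤ ℓ (m + n) + ℓ m) :
    ∃ c₀, ∀ m n, ℓ m + ℓ n ≤ ℓ (m + n) + c₀ := by
  obtain ⟨n₀, hn₀⟩ : ∃ n₀ : ℕ, ∀ k, n₀ ≤ k → 2 * (ℓ 1 + c) + c < ℓ k := by
    obtain ⟨n₀, h⟩ := exists_nat_gt ((2 * (ℓ 1 + c) + c + c') / C)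
    refine ⟨n₀, fun k hk => lt_of_lt_of_le ?_ (hℓ k)⟩
    rw [div_lt_iff₀ hC] at h
    have : (n₀ : ℝ) ≤ k := by exact_mod_cast hk
    nlinarith
  have main : ∀ m n, n₀ ≤ m → n₀ ≤ n → ℓ m + ℓ n ≤ ℓ (m + n) + 3 * c := by
    rcases lt_trichotomy 0 (τ n₀ - τ 0) with h | h | h
    · exact exists_superadditive_of_tracks_of_pos hτ hn₀ h
    · have h1 := hn₀ n₀ le_rfl
      have h2 := (abs_le.1 (hτ 0 n₀)).1
      have h3 := (abs_le.1 (hτ 0 1)).2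
      have h4 := abs_nonneg (τ (0 + 1) - τ 0)
      rw [zero_add, ← h, abs_zero] at h2
      linarith
    · refine exists_superadditive_of_tracks_of_pos (τ := fun n => -τ n) (fun m k => ?_) hn₀
        (by simpa using h)
      have := hτ m k
      rwa [abs_sub_comm (τ (m + k)), show τ m - τ (m + k) = -τ (m + k) - -τ m by ring] at this
  have h1 : 0 ≤ ℓ 1 := by linarith [hsub' 1 0, hsub 1 0]
  have lin : ∀ m : ℕ, ℓ m ≤ ℓ 0 + m * ℓ 1 := by
    intro m
    induction m with
    | zero => simp
    | succ m ih =>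
      have := hsub m 1
      push_cast
      linarith
  have small : ∀ m, m ≤ n₀ → ℓ m ≤ ℓ 0 + n₀ * ℓ 1 := fun m hm =>
    (lin m).trans (by gcongr)
  refine ⟨max (3 * c) (2 * (ℓ 0 + n₀ * ℓ 1)), fun m n => ?_⟩
  have m1 := le_max_left (3 * c) (2 * (ℓ 0 + n₀ * ℓ 1))
  have m2 := le_max_right (3 * c) (2 * (ℓ 0 + n₀ * ℓ 1))
  rcases le_total n₀ m with hm | hm
  · rcases le_total n₀ n with hn | hn
    · linarith [main m n hm hn]
    · have := hsub' n m
      rw [add_comm n m] at this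
      linarith [small n hn]
  · linarith [hsub' m n, small m hm]

end Superadditive

/-! ### Orbits of hyperbolic isometries -/

section Orbit

variable {G : Type*} [Group G] {X : Type*} [MetricSpace X] [MulAction G X] [IsIsometricSMul G X]

theorem dist_pow_smul_add (f : G) (o : X) (m n : ℕ) :
    dist (f ^ m • o) (f ^ (m + n) • o) = dist o (f ^ n • o) := by
  rw [pow_add, mul_smul, dist_smul]

theorem dist_zpow_natAbs (f : G) (o : X) (n : ℤ) :
    dist o (f ^ n • o) = dist o (f ^ n.natAbs • o) := by
  rcases Int.natAbs_eq n with h | h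
  · conv_lhs => rw [h, zpow_natCast]
  · conv_lhs => rw [h, zpow_neg, zpow_natCast]
    rw [← dist_smul (f ^ n.natAbs), smul_inv_smul, dist_comm]

theorem ActsHyperbolically.exists_le_dist {f : G} (hf : ActsHyperbolically X f) (o : X) :
    ∃ C c : ℝ, 0 < C ∧ 0 ≤ c ∧ ∀ n : ℤ, C * |(n : ℝ)| - c ≤ dist o (f ^ n • o) := by
  obtain ⟨x, C, hC, h⟩ := hf
  refine ⟨C, 2 * dist x o, hC, by positivity, fun n => ?_⟩
  rw [dist_zpow_natAbs, ← Int.cast_abs, Int.abs_eq_natAbs, Int.cast_natCast]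
  have h1 : C * n.natAbs ≤ dist x (f ^ n.natAbs • x) := by
    rcases Nat.eq_zero_or_pos n.natAbs with h0 | h0
    · simp [h0]
    · exact h _ h0
  have h2 := dist_triangle4 x o (f ^ n.natAbs • o) (f ^ n.natAbs • x)
  rw [dist_smul, dist_comm o x] at h2
  linarith

/-- Each f^n maps the quasi-axis into some neighborhood of itself, hence into the 6d-neighborhood,
uniformly in n. The orbit of a point of the axis is thus tracked by parameters on the axis, with
error 6d at each end of an increment. -/
theorem FourPoint.exists_superadditive {d : ℝ} (h4 : FourPoint X d) {f : G}
    (hf : ActsHyperbolically X f) {α : Set X} (hα : IsQuasiAxis f α) :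
    ∃ (o : X) (c₀ : ℝ), ∀ m n : ℕ,
      dist o (f ^ m • o) + dist o (f ^ n • o) ≤ dist o (f ^ (m + n) • o) + c₀ := by
  obtain ⟨⟨γ, hγ, rfl⟩, A, -, hA⟩ := hα
  have hA' : ∀ t, ∃ s, dist (f • γ t) (γ s) ≤ A := fun t => by
    obtain ⟨q, ⟨s, rfl⟩, hs⟩ := hA (f • γ t) ⟨γ t, ⟨t, rfl⟩, rfl⟩
    exact ⟨s, hs⟩
  have hn : ∀ n : ℕ, ∀ t, ∃ s, dist (f ^ n • γ t) (γ s) ≤ n * A := by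
    intro n
    induction n with
    | zero => exact fun t => ⟨t, by simp⟩
    | succ n ih =>
      intro t
      obtain ⟨s, hs⟩ := hA' t
      obtain ⟨u, hu⟩ := ih s
      refine ⟨u, ?_⟩
      have := dist_triangle (f ^ (n + 1) • γ t) (f ^ n • γ s) (γ u)
      rw [pow_succ, mul_smul, dist_smul] at this
      rw [pow_succ, mul_smul]
      push_cast
      linarith
  have hτ : ∀ n : ℕ, ∃ s, dist (f ^ n • γ 0) (γ s) ≤ 6 * d := fun n =>
    h4.exists_dist_le_of_inNeighborhood (γ' := fun t => f ^ n • γ t) hγ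
      ((isometry_smul X (f ^ n)).comp hγ) (hn n) 0
  choose τ hτ using hτ
  obtain ⟨C, c, hC, -, hCc⟩ := hf.exists_le_dist (γ 0)
  have htr : ∀ m k, |(|τ (m + k) - τ m|) - dist (γ 0) (f ^ k • γ 0)| ≤ 12 * d := by
    intro m k
    have e : |τ (m + k) - τ m| = dist (γ (τ m)) (γ (τ (m + k))) := by
      rw [hγ.dist_eq, Real.dist_eq, abs_sub_comm]
    rw [e, ← dist_pow_smul_add f (γ 0) m k, abs_le]
    have a1 := hτ m
    have a2 := hτ (m + k)
    have t1 := dist_triangle4 (γ (τ m)) (f ^ m • γ 0) (f ^ (m + k) • γ 0) (γ (τ (m + k)))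
    have t2 := dist_triangle4 (f ^ m • γ 0) (γ (τ m)) (γ (τ (m + k))) (f ^ (m + k) • γ 0)
    rw [dist_comm (γ (τ m)) (f ^ m • γ 0)] at t1
    rw [dist_comm (γ (τ (m + k))) (f ^ (m + k) • γ 0)] at t2
    constructor <;> linarith
  obtain ⟨c₀, h⟩ := exists_superadditive_of_tracks hC htr (fun k => by simpa using hCc k)
    (fun m n => by
      have := dist_triangle (γ 0) (f ^ m • γ 0) (f ^ (m + n) • γ 0)
      rwa [dist_pow_smul_add] at this)
    (fun m n => by
      have := dist_triangle (f ^ m • γ 0) (γ 0) (f ^ (m + n) • γ 0)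
      rw [dist_pow_smul_add, dist_comm _ (γ 0)] at this
      linarith)
  exact ⟨γ 0, c₀, h⟩

end Orbit

/-! ### Acylindricity and fellow-travelling orbits -/

section Overlap

variable {G : Type*} [Group G] {X : Type*} [MetricSpace X] [MulAction G X] [IsIsometricSMul G X]

theorem gromovProduct_le_left (o x y : X) : gromovProduct o x y ≤ dist o x := by
  have := dist_triangle o x y
  unfold gromovProduct
  linarith

theorem gromovProduct_le_right (o x y : X) : gromovProduct o x y ≤ dist o y := by
  rw [gromovProduct_comm]
  exact gromovProduct_le_left o y x

theorem FourPoint.nonneg {d : ℝ} (h4 : FourPoint X d) (o : X) : 0 ≤ d := by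
  simpa [gromovProduct] using h4 o o o o

/-- Orbits of two coarsely additive isometries of the same displacement fellow travel as long as
they do not diverge. -/
theorem FourPoint.dist_pow_smul_le {d : ℝ} (h4 : FourPoint X d) {ℓ : ℕ → ℝ} {c₀ E M : ℝ}
    (hadd : ∀ m n, ℓ m + ℓ n ≤ ℓ (m + n) + c₀) {o : X} {F F' h : G}
    (hF : ∀ n : ℕ, dist o (F ^ n • o) = ℓ n) (hF' : ∀ n : ℕ, dist o (F' ^ n • o) = ℓ n)
    (hE : dist o (h • o) ≤ E) {r l m : ℕ} (hr : m ≤ r) (hl : m ≤ l) (hm : ℓ m ≤ M)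
    (hM : M ≤ gromovProduct o (F ^ r • o) (h • F' ^ l • o)) :
    dist (F ^ m • o) (h • F' ^ m • o) ≤ c₀ + 3 * E + 4 * d := by
  obtain ⟨r, rfl⟩ := Nat.exists_eq_add_of_le hr
  obtain ⟨l, rfl⟩ := Nat.exists_eq_add_of_le hl
  have hd := h4.nonneg o
  have hE0 : 0 ≤ E := dist_nonneg.trans hE
  have hc₀ : 0 ≤ c₀ := by
    have h0 : 0 ≤ ℓ 0 := (hF 0) ▸ dist_nonneg
    linarith [hadd 0 0]
  have e1 := dist_pow_smul_add F o m r
  have e2 : dist (h • F' ^ m • o) (h • F' ^ (m + l) • o) = ℓ l := by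
    rw [dist_smul, dist_pow_smul_add, hF']
  have key : ∀ n, |dist o (h • F' ^ n • o) - ℓ n| ≤ E := by
    intro n
    have e : dist (h • o) (h • F' ^ n • o) = ℓ n := by rw [dist_smul, hF']
    have t1 := dist_triangle o (h • o) (h • F' ^ n • o)
    have t2 := dist_triangle (h • o) o (h • F' ^ n • o)
    rw [dist_comm (h • o) o] at t2
    rw [abs_le]
    constructor <;> linarith
  have k1 := abs_le.1 (key m)
  have k2 := abs_le.1 (key (m + l))
  have a1 := hadd m r
  have a2 := hadd m l
  have f1 := hF m
  have f2 := hF (m + r)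
  have f3 := hF r
  -- In the chain F^m o, F^(m+r) o, h F'^(m+l) o, h F'^m o consecutive products are at least ℓ m up
  -- to bounded errors. So is the product of the ends, whose distances to o are about ℓ m; hence the
  -- ends are close.
  have i1 := h4 o (F ^ m • o) (F ^ (m + r) • o) (h • F' ^ m • o)
  have i2 := h4 o (F ^ (m + r) • o) (h • F' ^ (m + l) • o) (h • F' ^ m • o)
  simp only [gromovProduct, dist_comm (h • F' ^ (m + l) • o) (h • F' ^ m • o)] at *
  rcases min_le_iff.1 i1 with i1 | i1
  · linarith
  · rcases min_le_iff.1 i2 with i2 | i2 <;> linarith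

/-- The element steps back to F^(m-s) o and then forward along the other orbit, arriving near h F'^m
o; fellow travelling is used at times m - s and m. -/
theorem dist_conj_pow_smul_le {o : X} {F F' h : G} {s m : ℕ} {R : ℝ} (hs : s ≤ m)
    (hR : ∀ k ≤ m, dist (F ^ k • o) (h • F' ^ k • o) ≤ R) :
    dist (F ^ m • o) ((h * F' ^ s * h⁻¹ * (F ^ s)⁻¹) • F ^ m • o) ≤ 2 * R := by
  obtain ⟨m, rfl⟩ := Nat.exists_eq_add_of_le hs
  have e1 : (h * F' ^ s * h⁻¹ * (F ^ s)⁻¹) • F ^ (s + m) • o =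
      (h * F' ^ s * h⁻¹) • F ^ m • o := by
    simp only [smul_smul, pow_add, mul_assoc, inv_mul_cancel_left]
  have e2 : h • F' ^ (s + m) • o = (h * F' ^ s * h⁻¹) • h • F' ^ m • o := by
    simp only [smul_smul, pow_add, mul_assoc, inv_mul_cancel_left]
  have h1 := hR (s + m) le_rfl
  have h2 := hR m (by omega)
  have t := dist_triangle (F ^ (s + m) • o) (h • F' ^ (s + m) • o)
    ((h * F' ^ s * h⁻¹) • F ^ m • o)
  rw [e1]
  rw [e2, dist_smul, dist_comm (h • F' ^ m • o), ← e2] at t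
  linarith

/-- If the orbit of a hyperbolic isometry and a translate of it fellow travel for long, then some
power is conjugated to a power. -/
theorem MetricGraph.IsAcylindrical.exists_gromovProduct_le {Γ : MetricGraph X}
    (hG : Γ.IsAcylindrical G) {d : ℝ} (h4 : FourPoint X d) {ℓ : ℕ → ℝ} {C c c₀ : ℝ} (hC : 0 < C)
    (hℓ : ∀ n : ℕ, C * n - c ≤ ℓ n) (hadd : ∀ m n, ℓ m + ℓ n ≤ ℓ (m + n) + c₀) (o : X) (E : ℝ) :
    ∃ M, ∀ F F' h : G, (∀ n : ℕ, dist o (F ^ n • o) = ℓ n) →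
      (∀ n : ℕ, dist o (F' ^ n • o) = ℓ n) → dist o (h • o) ≤ E →
      (∀ j : ℕ, j ≠ 0 → h * F' ^ j * h⁻¹ ≠ F ^ j) →
      ∀ r l : ℕ, gromovProduct o (F ^ r • o) (h • F' ^ l • o) ≤ M := by
  set R₀ := c₀ + 3 * E + 4 * d with hR₀
  -- Acylindricity speaks of vertices only. Replacing an orbit point by a vertex at distance at most
  -- 1 adds 2 to its displacement, and doing so at both ends costs 2 in the separation, whence L + 2
  -- below.
  obtain ⟨K, L, -, -, hKL⟩ := hG (2 * |R₀| + 2) (by positivity)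
  obtain ⟨k, hk⟩ : ∃ k : ℕ, L + 2 ≤ ℓ k := by
    obtain ⟨k, hk⟩ := exists_nat_gt ((L + 2 + c) / C)
    rw [div_lt_iff₀ hC] at hk
    exact ⟨k, by linarith [hℓ k]⟩
  -- A product above M + |E| then forces both exponents to be at least K + k.
  obtain ⟨M, hM⟩ := ((Finset.range (K + k + 1)).image ℓ).exists_le
  have hM' : ∀ m ≤ K + k, ℓ m ≤ M := fun m hm =>
    hM _ (Finset.mem_image_of_mem _ (Finset.mem_range.2 (by omega)))
  refine ⟨M + |E|, fun F F' h hF hF' hE hne r l => ?_⟩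
  by_contra! hlt
  have hE0 : 0 ≤ E := dist_nonneg.trans hE
  rw [abs_of_nonneg hE0] at hlt
  have hr : K + k ≤ r := by
    by_contra! hr
    have := gromovProduct_le_left o (F ^ r • o) (h • F' ^ l • o)
    rw [hF] at this
    linarith [hM' r hr.le]
  have hl : K + k ≤ l := by
    by_contra! hl
    have h1 := gromovProduct_le_right o (F ^ r • o) (h • F' ^ l • o)
    have h2 := dist_triangle o (h • o) (h • F' ^ l • o)
    rw [dist_smul, hF'] at h2
    linarith [hM' l hl.le]
  have hfel : ∀ m ≤ K + k, dist (F ^ m • o) (h • F' ^ m • o) ≤ |R₀| := fun m hm =>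
    (h4.dist_pow_smul_le hadd hF hF' hE (hm.trans hr) (hm.trans hl) (hM' m hm)
      (by linarith)).trans (le_abs_self _)
  obtain ⟨v, hv, hvd⟩ := Γ.exists_vertex_dist_le (F ^ K • o)
  obtain ⟨w, hw, hwd⟩ := Γ.exists_vertex_dist_le (F ^ (K + k) • o)
  have hvw : L ≤ dist v w := by
    have e := dist_pow_smul_add F o K k
    rw [hF] at e
    have t := dist_triangle4 (F ^ K • o) v w (F ^ (K + k) • o)
    rw [dist_comm _ v] at t
    linarith
  have move : ∀ {u p : X} (a : G), dist u p ≤ 1 → dist p (a • p) ≤ 2 * |R₀| →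
      dist u (a • u) ≤ 2 * |R₀| + 2 := by
    intro u p a h1 h2
    have t := dist_triangle4 u p (a • p) (a • u)
    rw [dist_smul, dist_comm p u] at t
    linarith
  -- One more element than acylindricity allows. A coincidence between two of them would make h
  -- conjugate F'^j to F^j with j the difference of the indices.
  set φ : Fin (K + 1) → G := fun s => h * F' ^ (s : ℕ) * h⁻¹ * (F ^ (s : ℕ))⁻¹ with hφ
  have hinj : Function.Injective φ := by
    have aux : ∀ s t : ℕ, s < t →
        h * F' ^ s * h⁻¹ * (F ^ s)⁻¹ ≠ h * F' ^ t * h⁻¹ * (F ^ t)⁻¹ := by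
      intro s t hst heq
      obtain ⟨j, rfl⟩ := Nat.exists_eq_add_of_lt hst
      refine hne (j + 1) (by omega) ?_
      have e : h * F' ^ (s + j + 1) * h⁻¹ * (F ^ (s + j + 1))⁻¹ =
          h * F' ^ s * h⁻¹ * (h * F' ^ (j + 1) * h⁻¹ * (F ^ (j + 1))⁻¹) * (F ^ s)⁻¹ := by
        rw [add_assoc, pow_add, pow_add]
        group
      rw [e, mul_left_inj, left_eq_mul, mul_inv_eq_one] at heq
      exact heq
    intro s t hst
    rcases lt_trichotomy (s : ℕ) t with hlt | heq | hgt
    · exact absurd hst (aux _ _ hlt)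
    · exact Fin.ext heq
    · exact absurd hst.symm (aux _ _ hgt)
  have hsub : Set.range φ ⊆ {a : G | dist v (a • v) ≤ 2 * |R₀| + 2 ∧
      dist w (a • w) ≤ 2 * |R₀| + 2} := by
    rintro _ ⟨s, rfl⟩
    have hs : (s : ℕ) ≤ K := Nat.lt_succ_iff.1 s.2
    exact ⟨move _ hvd (dist_conj_pow_smul_le hs fun m hm => hfel m (by omega)),
      move _ hwd (dist_conj_pow_smul_le (by omega) fun m hm => hfel m (by omega))⟩
  have hcard := (Set.encard_le_encard hsub).trans (hKL v hv w hw hvw)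
  rw [← Set.image_univ, hinj.encard_image, Set.encard_univ, ENat.card_eq_coe_fintype_card,
    Fintype.card_fin] at hcard
  exact absurd (by exact_mod_cast hcard : K + 1 ≤ K) (by omega)

end Overlap

/-! ### Divergence of the orbits of f and g -/

section Independent

variable {G : Type*} [Group G] {X : Type*} [MetricSpace X] [MulAction G X] [IsIsometricSMul G X]

/-- The signs of r and l decide whether F and F' are f or f⁻¹. Opposite signs are the reason for
also excluding conjugation of f^j to its inverse. -/
theorem exists_gromovProduct_zpow_le {Γ : MetricGraph X} (hG : Γ.IsAcylindrical G) {d : ℝ}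
    (h4 : FourPoint X d) {f : G} (hf : ActsHyperbolically X f) {o : X} {c₀ : ℝ}
    (hadd : ∀ m n : ℕ,
      dist o (f ^ m • o) + dist o (f ^ n • o) ≤ dist o (f ^ (m + n) • o) + c₀) (E : ℝ) :
    ∃ M, ∀ h : G, dist o (h • o) ≤ E →
      (∀ j : ℤ, j ≠ 0 → h * f ^ j * h⁻¹ ≠ f ^ j ∧ h * f ^ j * h⁻¹ ≠ f ^ (-j)) →
      ∀ r l : ℤ, gromovProduct o (f ^ r • o) (h • f ^ l • o) ≤ M := by
  obtain ⟨C, c, hC, -, hCc⟩ := hf.exists_le_dist o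
  obtain ⟨M, hM⟩ := hG.exists_gromovProduct_le h4 (ℓ := fun n => dist o (f ^ n • o)) hC
    (fun k => by simpa using hCc k) hadd o E
  refine ⟨M, fun h hE hne r l => ?_⟩
  have hinv : ∀ n : ℕ, dist o (f⁻¹ ^ n • o) = dist o (f ^ n • o) := fun n => by
    have := dist_zpow_natAbs f o (-(n : ℤ))
    simpa using this
  have hn : ∀ j : ℕ, j ≠ 0 → (j : ℤ) ≠ 0 := fun j hj => by exact_mod_cast hj
  rcases Int.eq_nat_or_neg r with ⟨r, rfl | rfl⟩ <;>
    rcases Int.eq_nat_or_neg l with ⟨l, rfl | rfl⟩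
  · simpa using hM f f h (fun _ => rfl) (fun _ => rfl) hE
      (fun j hj => by simpa using (hne j (hn j hj)).1) r l
  · simpa using hM f f⁻¹ h (fun _ => rfl) hinv hE
      (fun j hj => by simpa using (hne (-j) (neg_ne_zero.2 (hn j hj))).2) r l
  · simpa using hM f⁻¹ f h hinv (fun _ => rfl) hE
      (fun j hj => by simpa using (hne j (hn j hj)).2) r l
  · simpa using hM f⁻¹ f⁻¹ h hinv hinv hE
      (fun j hj => by simpa using (hne (-j) (neg_ne_zero.2 (hn j hj))).1) r l

/-- If g^a inverts f^j, then g^(2a) commutes with f^j. -/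
theorem conj_zpow_ne_of_commutator_ne {f g : G}
    (hfg : ∀ s t : ℤ, s ≠ 0 → t ≠ 0 → (f ^ s)⁻¹ * (g ^ t)⁻¹ * f ^ s * g ^ t ≠ 1) {a j : ℤ}
    (ha : a ≠ 0) (hj : j ≠ 0) :
    g ^ a * f ^ j * (g ^ a)⁻¹ ≠ f ^ j ∧ g ^ a * f ^ j * (g ^ a)⁻¹ ≠ f ^ (-j) := by
  have comm : ∀ t : ℤ, t ≠ 0 → g ^ t * f ^ j * (g ^ t)⁻¹ ≠ f ^ j := by
    intro t ht h
    refine hfg j t hj ht ?_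
    rw [mul_inv_eq_iff_eq_mul] at h
    rw [mul_assoc, ← h]
    group
  refine ⟨comm a ha, fun h => comm (a + a) (by omega) ?_⟩
  have h' : g ^ a * f ^ (-j) * (g ^ a)⁻¹ = f ^ j := by
    rw [← inv_inj, ← zpow_neg f j]
    refine Eq.trans ?_ h
    group
  calc g ^ (a + a) * f ^ j * (g ^ (a + a))⁻¹
      = g ^ a * (g ^ a * f ^ j * (g ^ a)⁻¹) * (g ^ a)⁻¹ := by
        rw [zpow_add]
        group
    _ = f ^ j := by rw [h, h']

/-- The orbits of `⟨f⟩` and of `⟨g⟩` diverge. -/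
theorem FourPoint.gromovProduct_zpow_zpow_le {d : ℝ} (h4 : FourPoint X d) {f g : G} {o : X} {M : ℝ}
    (hM : ∀ r : ℤ, gromovProduct o (f ^ r • o) (g • f ^ r • o) ≤ M) (r a : ℤ) :
    gromovProduct o (f ^ r • o) (g ^ a • o) ≤ M + dist o (g • o) + 2 * d := by
  have hd := h4.nonneg o
  have h0 := hM r
  have e1 : dist (g ^ (a + 1) • o) (g • f ^ r • o) = dist (f ^ r • o) (g ^ a • o) := by
    rw [add_comm, zpow_one_add, mul_smul, dist_smul, dist_comm]
  have e2 : dist (g ^ a • o) (g ^ (a + 1) • o) = dist o (g • o) := by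
    rw [zpow_add_one, mul_smul, dist_smul]
  have e3 : dist (g • o) (g ^ (a + 1) • o) = dist o (g ^ a • o) := by
    rw [add_comm, zpow_one_add, mul_smul, dist_smul]
  have e4 : dist (g • o) (g • f ^ r • o) = dist o (f ^ r • o) := by rw [dist_smul]
  -- If f^r o and g^a o stayed together, so would their images under g. As g moves g^a o by |g|
  -- only, the chain f^r o, g^a o, g^(a+1) o, g f^r o would give f^r o and g f^r o a large product.
  have i1 := h4 o (f ^ r • o) (g ^ a • o) (g • f ^ r • o)
  have i2 := h4 o (g ^ a • o) (g ^ (a + 1) • o) (g • f ^ r • o)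
  have t1 := dist_triangle (g • o) o (g ^ (a + 1) • o)
  have t2 := dist_triangle (g • o) o (g • f ^ r • o)
  have t3 := dist_triangle_right o (f ^ r • o) (g ^ a • o)
  have p := dist_nonneg (x := o) (y := g • o)
  simp only [gromovProduct, dist_comm (g • o) o] at *
  rcases min_le_iff.1 i1 with i1 | i1
  · linarith
  · rcases min_le_iff.1 i2 with i2 | i2 <;> linarith

/-- The translates of the orbit of `⟨f⟩` by the powers of `g` diverge from it, uniformly. -/
theorem exists_gromovProduct_zpow_mul_zpow_le {Γ : MetricGraph X} (hG : Γ.IsAcylindrical G) {d : ℝ}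
    (h4 : FourPoint X d) {f g : G} (hf : ActsHyperbolically X f) {o : X} {c₀ : ℝ}
    (hadd : ∀ m n : ℕ,
      dist o (f ^ m • o) + dist o (f ^ n • o) ≤ dist o (f ^ (m + n) • o) + c₀)
    (hfg : ∀ s t : ℤ, s ≠ 0 → t ≠ 0 → (f ^ s)⁻¹ * (g ^ t)⁻¹ * f ^ s * g ^ t ≠ 1) :
    ∃ D, 0 ≤ D ∧ ∀ r l a : ℤ, a ≠ 0 ∨ l = 0 →
      gromovProduct o (f ^ r • o) (g ^ a • f ^ l • o) ≤ D := by
  have hd := h4.nonneg o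
  obtain ⟨M₁, hM₁⟩ := exists_gromovProduct_zpow_le hG h4 hf hadd (dist o (g • o))
  have hD₁ := h4.gromovProduct_zpow_zpow_le (g := g) (fun r => hM₁ g le_rfl (fun j hj => by
    simpa using conj_zpow_ne_of_commutator_ne hfg one_ne_zero hj) r r)
  set D₁ := M₁ + dist o (g • o) + 2 * d
  -- Beyond this threshold for |g^a|, the product of g^a f^l o with g^a o exceeds D₁ + d, while that
  -- of f^r o with g^a o is at most D₁. The four-point condition then bounds the required product by
  -- D₁ + d.
  obtain ⟨M₂, hM₂⟩ := exists_gromovProduct_zpow_le hG h4 hf hadd (2 * D₁ + d)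
  have hle : ∀ {x}, x ≤ D₁ + d ∨ x ≤ M₂ ∨ x ≤ 0 → x ≤ max 0 (max (D₁ + d) M₂) := by
    intro x hx
    simpa [le_max_iff, or_comm, or_assoc, or_left_comm] using hx
  refine ⟨max 0 (max (D₁ + d) M₂), le_max_left _ _, fun r l a hal => ?_⟩
  rcases eq_or_ne a 0 with rfl | ha
  · obtain rfl := hal.resolve_left (not_not.2 rfl)
    exact hle (Or.inr (Or.inr (by simp [gromovProduct, dist_comm])))
  · rcases le_or_gt (dist o (g ^ a • o)) (2 * D₁ + d) with h | h
    · exact hle (Or.inr (Or.inl (hM₂ _ h (fun j hj =>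
        conj_zpow_ne_of_commutator_ne hfg ha hj) r l)))
    · refine hle (Or.inl ?_)
      have h1 := hD₁ r a
      have h2 := hD₁ l (-a)
      rw [gromovProduct_comm, zpow_neg, ← gromovProduct_smul (g ^ a), smul_inv_smul] at h2
      have i := h4 o (f ^ r • o) (g ^ a • f ^ l • o) (g ^ a • o)
      rcases min_le_iff.1 i with i | i
      · linarith
      · simp only [gromovProduct, dist_comm (g ^ a • o) o,
          dist_comm (g ^ a • f ^ l • o) (g ^ a • o)] at *
        linarith

end Independent

/-! ### Alternating normal forms -/

section Words

/-- The word `y ^ a * x ^ b₁ * y ^ a₁ * x ^ b₂ * y ^ a₂ * ⋯`, where the list consists of the pairs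
`(bᵢ, aᵢ)`. -/
def alternatingProd {H : Type*} [Group H] (x y : H) : ℤ → List (ℤ × ℤ) → H
  | a, [] => y ^ a
  | a, p :: L => y ^ a * x ^ p.1 * alternatingProd x y p.2 L

/-- All exponents, but possibly the last one, are non-zero. -/
def IsAlternating : List (ℤ × ℤ) → Prop
  | [] => True
  | p :: L => p.1 ≠ 0 ∧ (p.2 ≠ 0 ∨ L = []) ∧ IsAlternating L

/-- The sum of the absolute values of the exponents. -/
def exponentSum : List (ℤ × ℤ) → ℕ
  | [] => 0
  | p :: L => p.1.natAbs + p.2.natAbs + exponentSum L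

variable {H : Type*} [Group H]

theorem map_alternatingProd {H' : Type*} [Group H'] (φ : H →* H') (x y : H) (a : ℤ)
    (L : List (ℤ × ℤ)) :
    φ (alternatingProd x y a L) = alternatingProd (φ x) (φ y) a L := by
  induction L generalizing a with
  | nil => simp [alternatingProd]
  | cons p L ih => simp [alternatingProd, ih]

theorem exists_zpow_mul_alternatingProd (x y : H) {k : ℤ} (hk : k ≠ 0) (a : ℤ)
    {L : List (ℤ × ℤ)} (hL : IsAlternating L) : ∃ (a' : ℤ) (L' : List (ℤ × ℤ)),
      IsAlternating L' ∧ x ^ k * alternatingProd x y a L = alternatingProd x y a' L' := by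
  have cons : a ≠ 0 ∨ L = [] → ∃ (a' : ℤ) (L' : List (ℤ × ℤ)),
      IsAlternating L' ∧ x ^ k * alternatingProd x y a L = alternatingProd x y a' L' := fun h =>
    ⟨0, (k, a) :: L, ⟨hk, h, hL⟩, by simp [alternatingProd]⟩
  rcases eq_or_ne a 0 with rfl | ha
  · cases L with
    | nil => exact cons (Or.inr rfl)
    | cons p L =>
      rcases eq_or_ne (k + p.1) 0 with h | h
      · refine ⟨p.2, L, hL.2.2, ?_⟩
        rw [alternatingProd, zpow_zero, one_mul, ← mul_assoc, ← zpow_add, h, zpow_zero, one_mul]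
      · refine ⟨0, (k + p.1, p.2) :: L, ⟨h, hL.2⟩, ?_⟩
        simp [alternatingProd, zpow_add, mul_assoc]
  · exact cons (Or.inl ha)

theorem zpow_mul_alternatingProd (x y : H) (k a : ℤ) (L : List (ℤ × ℤ)) :
    y ^ k * alternatingProd x y a L = alternatingProd x y (k + a) L := by
  cases L <;> simp [alternatingProd, zpow_add, mul_assoc]

theorem exists_eq_alternatingProd {x y : H} (hxy : Subgroup.closure {y, x} = ⊤) (w : H) :
    ∃ (a : ℤ) (L : List (ℤ × ℤ)), IsAlternating L ∧ w = alternatingProd x y a L := by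
  have step : ∀ u ∈ ({y, x} : Set H), ∀ k : ℤ, k ≠ 0 → ∀ v : H,
      (∃ (a : ℤ) (L : List (ℤ × ℤ)), IsAlternating L ∧ v = alternatingProd x y a L) →
      ∃ (a : ℤ) (L : List (ℤ × ℤ)), IsAlternating L ∧ u ^ k * v = alternatingProd x y a L := by
    rintro u (rfl | rfl) k hk v ⟨a, L, hL, rfl⟩
    · exact ⟨k + a, L, hL, zpow_mul_alternatingProd _ _ _ _ _⟩
    · exact exists_zpow_mul_alternatingProd _ _ hk a hL
  have hw : w ∈ Subgroup.closure {y, x} := hxy ▸ Subgroup.mem_top w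
  induction hw using Subgroup.closure_induction_left with
  | one => exact ⟨0, [], trivial, by simp [alternatingProd]⟩
  | mul_left u hu v hv ih => simpa using step u hu 1 one_ne_zero v ih
  | inv_mul_cancel u hu v hv ih => simpa using step u hu (-1) (by decide) v ih

end Words

/-! ### From bounded junctions to growth of words -/

section LocalToGlobal

variable {G : Type*} [Group G] {X : Type*} [MetricSpace X] [MulAction G X] [IsIsometricSMul G X]

theorem gromovProduct_add_gromovProduct_inv (h v : G) (o : X) :
    gromovProduct o (h • o) (h • v • o) + gromovProduct o (h⁻¹ • o) (v • o) =
      dist o (h • o) := by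
  rw [← gromovProduct_smul h o (h⁻¹ • o), smul_inv_smul]
  simp only [gromovProduct, dist_comm (h • o) o]
  ring

/-- As h is long and v does not backtrack along it, h o and h v o have product above D + d. Seen
from o they point in the same direction, and a z that diverges from one diverges from the other. -/
theorem FourPoint.gromovProduct_le_of_passes {d D : ℝ} (h4 : FourPoint X d) {h v : G} {o z : X}
    (hh : 2 * D + 2 * d < dist o (h • o)) (hv : gromovProduct o (h⁻¹ • o) (v • o) ≤ D + d)
    (hz : gromovProduct o z (h • o) ≤ D) : gromovProduct o z (h • v • o) ≤ D + d := by
  have h1 := gromovProduct_add_gromovProduct_inv h v o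
  rcases min_le_iff.1 (h4 o z (h • v • o) (h • o)) with i | i
  · linarith
  · rw [gromovProduct_comm] at i
    linarith

theorem dist_mul_smul (h v : G) (o : X) :
    dist o ((h * v) • o) =
      dist o (h • o) + dist o (v • o) - 2 * gromovProduct o (h⁻¹ • o) (v • o) := by
  rw [← gromovProduct_smul h o (h⁻¹ • o), smul_inv_smul, mul_smul]
  simp only [gromovProduct, dist_comm (h • o) o, dist_smul]
  ring

variable {f g : G} {o : X} {d D : ℝ}

theorem FourPoint.gromovProduct_alternatingProd_le (h4 : FourPoint X d)
    (hD : ∀ r l a : ℤ, a ≠ 0 ∨ l = 0 →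
      gromovProduct o (f ^ r • o) (g ^ a • f ^ l • o) ≤ D) (hD0 : 0 ≤ D)
    (hf : ∀ b : ℤ, b ≠ 0 → 4 * D + 4 * d < dist o (f ^ b • o)) {L : List (ℤ × ℤ)}
    (hL : IsAlternating L) {a : ℤ} (ha : a ≠ 0 ∨ L = []) (r : ℤ) :
    gromovProduct o (f ^ r • o) (alternatingProd f g a L • o) ≤ D + d := by
  have hd := h4.nonneg o
  have hDa : ∀ r a : ℤ, gromovProduct o (f ^ r • o) (g ^ a • o) ≤ D := fun r a => by
    simpa using hD r 0 a (Or.inr rfl)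
  induction L generalizing a r with
  | nil =>
    have := hDa r a
    simp only [alternatingProd]
    linarith
  | cons p L ih =>
    obtain ⟨hb, hp, hL'⟩ := hL
    have ha' := ha.resolve_right (by simp)
    have hv := ih hL' hp (-p.1)
    rw [zpow_neg] at hv
    have hbig := hf p.1 hb
    have q0 := gromovProduct_add_gromovProduct_inv (f ^ p.1) (alternatingProd f g p.2 L) o
    have q1 := h4.gromovProduct_le_of_passes (h := f ^ p.1) (by linarith) hv
      (z := (g ^ a)⁻¹ • o) (by
        rw [gromovProduct_comm, ← zpow_neg]
        exact hDa _ _)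
    have q2 := hDa p.1 (-a)
    rw [zpow_neg, gromovProduct_comm] at q2
    -- The word passes near its prefix g^a f^b o. With v the tail, this product is |g^a| + (f^b o |
    -- f^b v o) - (g^(-a) o | f^b o) - (g^(-a) o | f^b v o), at least |f^b| - 3D - 2d; hence the
    -- threshold 4D + 4d.
    have key : D + d < gromovProduct o (alternatingProd f g a (p :: L) • o)
        (g ^ a • f ^ p.1 • o) := by
      have e1 := dist_mul_smul (g ^ a) (f ^ p.1) o
      have e2 := dist_mul_smul (g ^ a) (f ^ p.1 * alternatingProd f g p.2 L) o
      have e3 : dist (alternatingProd f g a (p :: L) • o) (g ^ a • f ^ p.1 • o) =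
          dist (f ^ p.1 • alternatingProd f g p.2 L • o) (f ^ p.1 • o) := by
        simp only [alternatingProd, mul_smul, dist_smul]
      have e4 : dist o (alternatingProd f g a (p :: L) • o) =
          dist o ((g ^ a * (f ^ p.1 * alternatingProd f g p.2 L)) • o) := by
        rw [alternatingProd, mul_assoc]
      rw [gromovProduct_comm, gromovProduct, dist_comm (g ^ a • f ^ p.1 • o), e3, e4, e2,
        ← mul_smul, e1]
      rw [gromovProduct, dist_comm (f ^ p.1 • o)] at q0
      simp only [mul_smul] at *
      have := dist_nonneg (x := o) (y := g ^ a • o)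
      linarith
    rcases min_le_iff.1 (h4 o (f ^ r • o) (alternatingProd f g a (p :: L) • o)
      (g ^ a • f ^ p.1 • o)) with i | i
    · linarith [hD r p.1 a (Or.inl ha')]
    · linarith [hD r p.1 a (Or.inl ha')]

/-- The orbit map of the free group on `f` and `g` expands distances. -/
theorem FourPoint.le_dist_alternatingProd (h4 : FourPoint X d)
    (hD : ∀ r l a : ℤ, a ≠ 0 ∨ l = 0 →
      gromovProduct o (f ^ r • o) (g ^ a • f ^ l • o) ≤ D) (hD0 : 0 ≤ D) {κ c : ℝ} (hκ : 0 < κ)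
    (hc : 0 ≤ c) (hg : ∀ a : ℤ, κ * |(a : ℝ)| - c ≤ dist o (g ^ a • o))
    (hf : ∀ b : ℤ, b ≠ 0 → κ * |(b : ℝ)| + 4 * D + 4 * d + c ≤ dist o (f ^ b • o))
    {L : List (ℤ × ℤ)} (hL : IsAlternating L) (a : ℤ) :
    dist o (g ^ a • o) + κ * exponentSum L ≤ dist o (alternatingProd f g a L • o) := by
  have hd := h4.nonneg o
  have hf' : ∀ b : ℤ, b ≠ 0 → 4 * D + 4 * d < dist o (f ^ b • o) := fun b hb => by
    have : 0 < κ * |(b : ℝ)| := mul_pos hκ (abs_pos.2 (by exact_mod_cast hb))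
    linarith [hf b hb]
  induction L generalizing a with
  | nil => simp [alternatingProd, exponentSum]
  | cons p L ih =>
    obtain ⟨hb, hp, hL'⟩ := hL
    have hv := h4.gromovProduct_alternatingProd_le hD hD0 hf' hL' hp (-p.1)
    rw [zpow_neg] at hv
    have hbig := hf' p.1 hb
    have q1 := h4.gromovProduct_le_of_passes (h := f ^ p.1) (by linarith) hv
      (z := (g ^ a)⁻¹ • o) (by
        rw [gromovProduct_comm, ← zpow_neg]
        simpa using hD p.1 0 (-a) (Or.inr rfl))
    have e1 := dist_mul_smul (g ^ a) (f ^ p.1 * alternatingProd f g p.2 L) o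
    have e2 := dist_mul_smul (f ^ p.1) (alternatingProd f g p.2 L) o
    have h1 := hf p.1 hb
    have h2 := hg p.2
    have h3 := ih hL' p.2
    have e3 : (exponentSum (p :: L) : ℝ) = |(p.1 : ℝ)| + |(p.2 : ℝ)| + exponentSum L := by
      simp [exponentSum, Nat.cast_natAbs]
    -- The junctions on either side of f^b cost at most 2(D + d) each, and the next power of g may
    -- fall short by c. The surplus 4D + 4d + c in the length of f^b pays for all three.
    rw [e3, alternatingProd, mul_assoc, e1, e2]
    rw [← mul_smul] at q1
    linarith

end LocalToGlobal

/-! ### Word length, quasi-isometric orbits and freeness -/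

section WordLength

variable {H : Type*} [Group H] {S : Set H}

theorem wordLength_le_length {w : List H} (hw : ∀ u ∈ w, u ∈ S ∨ u⁻¹ ∈ S) :
    wordLength S w.prod ≤ w.length :=
  Nat.sInf_le ⟨w, hw, rfl, rfl⟩

theorem exists_word_length_eq (hS : Subgroup.closure S = ⊤) (a : H) :
    ∃ w : List H, (∀ u ∈ w, u ∈ S ∨ u⁻¹ ∈ S) ∧ w.prod = a ∧ w.length = wordLength S a := by
  have ha : a ∈ Submonoid.closure (S ∪ S⁻¹) := by
    rw [← Subgroup.closure_toSubmonoid, hS]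
    trivial
  obtain ⟨w, hw, rfl⟩ := Submonoid.exists_list_of_mem_closure ha
  exact Nat.sInf_mem (s := {k : ℕ | ∃ v : List H, (∀ u ∈ v, u ∈ S ∨ u⁻¹ ∈ S) ∧
    v.prod = w.prod ∧ v.length = k}) ⟨w.length, w, hw, rfl, rfl⟩

theorem wordLength_one : wordLength S (1 : H) = 0 :=
  Nat.le_zero.1 (wordLength_le_length (S := S) (w := []) (by simp))

theorem wordLength_mul_le (hS : Subgroup.closure S = ⊤) (a b : H) :
    wordLength S (a * b) ≤ wordLength S a + wordLength S b := by
  obtain ⟨v, hv, rfl, hv'⟩ := exists_word_length_eq hS a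
  obtain ⟨w, hw, rfl, hw'⟩ := exists_word_length_eq hS b
  rw [← hv', ← hw', ← List.prod_append, ← List.length_append]
  refine wordLength_le_length fun u hu => ?_
  rcases List.mem_append.1 hu with h | h
  exacts [hv u h, hw u h]

theorem wordLength_inv_le (hS : Subgroup.closure S = ⊤) (a : H) :
    wordLength S a⁻¹ ≤ wordLength S a := by
  obtain ⟨v, hv, rfl, hv'⟩ := exists_word_length_eq hS a
  rw [← hv', List.prod_inv_reverse]
  refine (wordLength_le_length fun u hu => ?_).trans (by simp)
  obtain ⟨t, ht, rfl⟩ := List.mem_map.1 (List.mem_reverse.1 hu)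
  rw [inv_inv]
  exact (hv t ht).symm

theorem wordLength_zpow_le (hS : Subgroup.closure S = ⊤) (a : H) (n : ℤ) :
    wordLength S (a ^ n) ≤ n.natAbs * wordLength S a := by
  have hpow : ∀ n : ℕ, wordLength S (a ^ n) ≤ n * wordLength S a := by
    intro n
    induction n with
    | zero => simp [wordLength_one]
    | succ n ih =>
      rw [pow_succ, add_mul, one_mul]
      exact (wordLength_mul_le hS _ _).trans (by omega)
  rcases Int.eq_nat_or_neg n with ⟨n, rfl | rfl⟩
  · simpa using hpow n
  · simpa using (wordLength_inv_le hS _).trans (hpow n)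

theorem wordLength_alternatingProd_le (hS : Subgroup.closure S = ⊤) {x y : H} {B : ℕ}
    (hx : wordLength S x ≤ B) (hy : wordLength S y ≤ B) (a : ℤ) (L : List (ℤ × ℤ)) :
    wordLength S (alternatingProd x y a L) ≤ B * (a.natAbs + exponentSum L) := by
  have hz : ∀ {z : H} (n : ℤ), wordLength S z ≤ B → wordLength S (z ^ n) ≤ B * n.natAbs :=
    fun {z} n h => (wordLength_zpow_le hS z n).trans (by rw [mul_comm]; gcongr)
  induction L generalizing a with
  | nil => simpa [alternatingProd, exponentSum] using hz a hy
  | cons p L ih =>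
    have h1 := wordLength_mul_le hS (y ^ a * x ^ p.1) (alternatingProd x y p.2 L)
    have h2 := wordLength_mul_le hS (y ^ a) (x ^ p.1)
    have h3 := ih p.2
    have h4 := hz a hy
    have h5 := hz p.1 hx
    simp only [alternatingProd, exponentSum, mul_add] at *
    omega

variable {X : Type*} [MetricSpace X] [MulAction H X]

/-- Orbit maps are Lipschitz. -/
theorem exists_dist_smul_le_wordLength [IsIsometricSMul H X] (hfin : S.Finite)
    (hS : Subgroup.closure S = ⊤) (x : X) :
    ∃ B : ℝ, 0 < B ∧ ∀ a : H, dist x (a • x) ≤ B * wordLength S a := by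
  obtain ⟨B, hB⟩ := (hfin.image fun u => dist x (u • x)).bddAbove
  have hB' : ∀ u, u ∈ S ∨ u⁻¹ ∈ S → dist x (u • x) ≤ max B 1 := by
    rintro u (h | h)
    · exact (hB ⟨u, h, rfl⟩).trans (le_max_left _ _)
    · refine le_trans ?_ ((hB ⟨u⁻¹, h, rfl⟩).trans (le_max_left _ _))
      dsimp only
      rw [← dist_smul u x (u⁻¹ • x), smul_inv_smul, dist_comm]
  refine ⟨max B 1, by positivity, fun a => ?_⟩
  obtain ⟨w, hw, rfl, hl⟩ := exists_word_length_eq hS a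
  rw [← hl]
  clear hl
  induction w with
  | nil => simp
  | cons u w ih =>
    have h1 := hB' u (hw u (by simp))
    have h2 := ih fun t ht => hw t (by simp [ht])
    have t := dist_triangle x (u • x) (u • w.prod • x)
    rw [dist_smul] at t
    rw [List.prod_cons, mul_smul, List.length_cons]
    push_cast
    linarith

/-- Passing from the generators x, y to S changes lengths by a bounded factor, and passing from o to
p changes displacements by at most 2 d(p, o). -/
theorem isQuasiIsometricOrbit_of_le_dist [IsIsometricSMul H X] (hfin : S.Finite)
    (hS : Subgroup.closure S = ⊤) {x y : H}
    (hxy : Subgroup.closure {y, x} = ⊤) {o : X} {κ c : ℝ} (hκ : 0 < κ)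
    (h : ∀ (a : ℤ) (L : List (ℤ × ℤ)), IsAlternating L →
      κ * (a.natAbs + exponentSum L) - c ≤ dist o (alternatingProd x y a L • o)) (p : X) :
    IsQuasiIsometricOrbit S p := by
  obtain ⟨B, hB, hBd⟩ := exists_dist_smul_le_wordLength hfin hS p
  set A : ℕ := max (wordLength S x) (wordLength S y) with hA
  -- The 1 keeps the quotient positive even if x and y are both trivial.
  have hQ : 0 < ((A : ℝ) + 1) / κ := by positivity
  refine ⟨max B ((A + 1) / κ), max 1 (c + 2 * dist p o), lt_max_of_lt_left hB,
    lt_max_of_lt_left one_pos, fun w => ⟨?_, ?_⟩⟩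
  · obtain ⟨a, L, hL, rfl⟩ := exists_eq_alternatingProd hxy w
    have h1 := h a L hL
    have h2 : (wordLength S (alternatingProd x y a L) : ℝ) ≤ A * (a.natAbs + exponentSum L) := by
      exact_mod_cast wordLength_alternatingProd_le hS (le_max_left _ _) (le_max_right _ _) a L
    have h3 : (wordLength S (alternatingProd x y a L) : ℝ) / max B ((A + 1) / κ) ≤
        κ * (a.natAbs + exponentSum L) := by
      calc (wordLength S (alternatingProd x y a L) : ℝ) / max B ((A + 1) / κ)
          ≤ wordLength S (alternatingProd x y a L) / ((A + 1) / κ) :=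
            div_le_div_of_nonneg_left (by positivity) hQ (le_max_right _ _)
        _ ≤ κ * (a.natAbs + exponentSum L) := by
            rw [div_le_iff₀ hQ]
            have : κ * (a.natAbs + exponentSum L) * ((A + 1) / κ) =
                A * (a.natAbs + exponentSum L) + (a.natAbs + exponentSum L : ℝ) := by
              field_simp
            rw [this]
            have : (0 : ℝ) ≤ a.natAbs + exponentSum L := by positivity
            linarith
    have t := dist_triangle4 o p (alternatingProd x y a L • p) (alternatingProd x y a L • o)
    rw [dist_smul, dist_comm o p] at t
    linarith [le_max_right 1 (c + 2 * dist p o)]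
  · have h1 : B * wordLength S w ≤ max B ((A + 1) / κ) * wordLength S w := by
      gcongr
      exact le_max_left _ _
    linarith [hBd w, le_max_left 1 (c + 2 * dist p o)]

theorem injective_freeGroup_lift_of_le_dist {x y : H} {o : X} {κ C c : ℝ} (hκ : 0 < κ)
    (hC : 0 < C) (hy : ∀ a : ℤ, C * |(a : ℝ)| - c ≤ dist o (y ^ a • o))
    (h : ∀ (a : ℤ) (L : List (ℤ × ℤ)), IsAlternating L →
      dist o (y ^ a • o) + κ * exponentSum L ≤ dist o (alternatingProd x y a L • o)) :
    Function.Injective (FreeGroup.lift ![y, x]) := by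
  rw [injective_iff_map_eq_one]
  intro w hw
  have hgen : Subgroup.closure {FreeGroup.of (0 : Fin 2), FreeGroup.of 1} = ⊤ := by
    rw [← FreeGroup.closure_range_of]
    congr 1
    ext u
    simp [Fin.exists_fin_two, eq_comm]
  obtain ⟨a, L, hL, rfl⟩ := exists_eq_alternatingProd hgen w
  rw [map_alternatingProd] at hw
  simp only [FreeGroup.lift_apply_of, Matrix.cons_val_zero, Matrix.cons_val_one] at hw
  have h1 := h a L hL
  rw [hw, one_smul, dist_self] at h1
  cases L with
  | nil =>
    have hya : y ^ a = 1 := by simpa [alternatingProd] using hw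
    have : a = 0 := by
      by_contra ha
      have ha' : 0 < |(a : ℝ)| := abs_pos.2 (by exact_mod_cast ha)
      -- The additive error c may hide a single power, so a high power of y^a = 1 is used.
      obtain ⟨k, hk⟩ := exists_nat_gt (c / (C * |(a : ℝ)|))
      rw [div_lt_iff₀ (by positivity)] at hk
      have := hy (a * k)
      rw [zpow_mul, hya, one_zpow, one_smul, dist_self] at this
      push_cast at this
      rw [abs_mul, abs_of_nonneg (Nat.cast_nonneg (α := ℝ) k)] at this
      linarith
    simp [this, alternatingProd]
  | cons p L =>
    exfalso
    have h2 : 0 < exponentSum (p :: L) := by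
      have := Int.natAbs_pos.2 hL.1
      simp only [exponentSum]
      omega
    have h3 : 0 < κ * exponentSum (p :: L) := mul_pos hκ (by exact_mod_cast h2)
    linarith [dist_nonneg (x := o) (y := y ^ a • o)]

end WordLength

/-! ### Choice of the exponent and conclusion -/

theorem proposition8 {G : Type*} [Group G] {X : Type*} [MetricSpace X] [MulAction G X]
    [IsIsometricSMul G X] (Γ : MetricGraph X) (δ : ℝ) (hδ : 0 ≤ δ)
    (hX : IsHyperbolicSpace X δ) (hG : Γ.IsAcylindrical G) (f g : G)
    (hf : ActsHyperbolically X f) (hg : ActsHyperbolically X g)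
    (α β : Set X) (hα : IsQuasiAxis f α) (hβ : IsQuasiAxis g β)
    (hfg : ∀ s t : ℤ, s ≠ 0 → t ≠ 0 → (f ^ s)⁻¹ * (g ^ t)⁻¹ * f ^ s * g ^ t ≠ 1) :
    ∃ N : ℕ, 0 < N ∧ ∀ n : ℕ, N ≤ n →
      Nonempty (Subgroup.closure {g, f ^ n} ≃* FreeGroup (Fin 2)) ∧
      ∀ S : Set (Subgroup.closure {g, f ^ n}), S.Finite → Subgroup.closure S = ⊤ →
        ∀ x : X, IsQuasiIsometricOrbit S x := by
  have h4 := hX.fourPoint hδ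
  set d := 3 * δ + 2
  obtain ⟨o, c₀, hadd⟩ := h4.exists_superadditive hf hα
  obtain ⟨D, hD0, hD⟩ := exists_gromovProduct_zpow_mul_zpow_le hG h4 hf hadd hfg
  obtain ⟨Cf, cf, hCf, hcf, hf'⟩ := hf.exists_le_dist o
  obtain ⟨C, c, hC, hc, hg'⟩ := hg.exists_le_dist o
  -- Chosen so that nonzero powers of f^n grow at the rate C of g with surplus 4D + 4d + c. The
  -- constant D is fixed before n, as it bounds the products for all powers of f at once.
  obtain ⟨N, hN⟩ := exists_nat_gt ((C + 4 * D + 4 * d + c + cf) / Cf)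
  rw [div_lt_iff₀ hCf] at hN
  refine ⟨N + 1, by omega, fun n hn => ?_⟩
  have hfn : ∀ b : ℤ, b ≠ 0 →
      C * |(b : ℝ)| + 4 * D + 4 * d + c ≤ dist o ((f ^ n) ^ b • o) := by
    intro b hb
    have h1 := hf' (n * b)
    rw [zpow_mul, zpow_natCast] at h1
    push_cast at h1
    rw [abs_mul, abs_of_nonneg (Nat.cast_nonneg n)] at h1
    have hb1 : 1 ≤ |(b : ℝ)| := by exact_mod_cast Int.one_le_abs hb
    have hNn : (N : ℝ) ≤ n := by exact_mod_cast (by omega : N ≤ n)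
    have hd := h4.nonneg o
    have h2 : (C + 4 * D + 4 * d + c + cf) * |(b : ℝ)| ≤ Cf * (n * |(b : ℝ)|) := by
      rw [← mul_assoc]
      gcongr
      nlinarith
    have h3 : 4 * D + 4 * d + c + cf ≤ (4 * D + 4 * d + c + cf) * |(b : ℝ)| :=
      le_mul_of_one_le_right (by positivity) hb1
    linarith
  have hDn : ∀ r l a : ℤ, a ≠ 0 ∨ l = 0 →
      gromovProduct o ((f ^ n) ^ r • o) (g ^ a • (f ^ n) ^ l • o) ≤ D := by
    intro r l a hal
    have := hD (n * r) (n * l) a (hal.imp_right fun h => by simp [h])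
    simpa only [zpow_mul, zpow_natCast] using this
  have hlow : ∀ (a : ℤ) (L : List (ℤ × ℤ)), IsAlternating L →
      dist o (g ^ a • o) + C * exponentSum L ≤ dist o (alternatingProd (f ^ n) g a L • o) :=
    fun a L hL => h4.le_dist_alternatingProd hDn hD0 hC hc hg' hfn hL a
  constructor
  · have hinj := injective_freeGroup_lift_of_le_dist hC hC hg' hlow
    have hrange : (FreeGroup.lift ![g, f ^ n]).range = Subgroup.closure {g, f ^ n} := by
      rw [FreeGroup.range_lift_eq_closure]
      simp [Set.pair_comm]
    exact ⟨((MonoidHom.ofInjective hinj).trans (MulEquiv.subgroupCongr hrange)).symm⟩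
  · intro S hfin hS x
    have : IsIsometricSMul (Subgroup.closure {g, f ^ n}) X := ⟨fun a => isometry_smul X (a : G)⟩
    let x₁ : Subgroup.closure {g, f ^ n} := ⟨f ^ n, Subgroup.subset_closure (by simp)⟩
    let y₁ : Subgroup.closure {g, f ^ n} := ⟨g, Subgroup.subset_closure (by simp)⟩
    have hxy : Subgroup.closure {y₁, x₁} = ⊤ := by
      rw [← Subgroup.closure_closure_coe_preimage]
      congr 1
      ext u
      simp [x₁, y₁, Subtype.ext_iff]
    refine isQuasiIsometricOrbit_of_le_dist hfin hS hxy (o := o) hC (c := c) (fun a L hL => ?_) x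
    have h1 := hlow a L hL
    have h2 := hg' a
    have e : alternatingProd x₁ y₁ a L • o = alternatingProd (f ^ n) g a L • o := by
      rw [Subgroup.smul_def]
      congr 1
      exact map_alternatingProd (Subgroup.closure {g, f ^ n}).subtype x₁ y₁ a L
    rw [e, Nat.cast_natAbs, Int.cast_abs]
    linarith
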